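/- **Setting.** Let $(\Omega,\mathcal F,\mathbb P,(\mathcal F_t)_{t\ge 0})$ be a complete filtered probability space satisfying the usual conditions and supporting a standard one-dimensional $(\mathcal F_t)$-Wiener process $W$; let $\mu,\sigma:[0,\infty)\to\mathbb R$ be measurable and let $r>0$. An *admissible control strategy* $D^i$ (the set of these is $\mathbb L$) consists of a measurable rate $\lambda^i:[0,\infty)\to[0,\infty)$; a set $B^i\subseteq[0,\infty)$ that is a finite union of closed connected subsets of $[0,\infty)$; a measurable $\mathcal J^i:[0,\infty)\to[0,\infty)$ with $\mathcal J^i(x)=0$ for $x\notin B^i$, $\mathcal J^i(x)\le x$ for all $x\geq 0$, and $\mathcal J^i(x)>0$ for $x\in\mathrm{Int}(B^i)$; and finitely many ($n_i\ge 0$) points $x^i_j\in(0,\infty)\setminus\mathrm{Int}(B^i)$ with constants $c^i_j\in(0,1]$, $j=1,\dots,n_i$. Here $\mathrm{Int}$ is the interior in $\mathbb R$, so that $\mathrm{Int}([0,\infty))=(0,\infty)$. For $(D^1,D^2)\in\mathbb L\times\mathbb L$ put $\alpha(y)=(y-\mathcal J^1(y)-\mathcal J^2(y))\vee 0$ and let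 $\alpha^j$ be its $j$-fold composition, $\alpha^0(y)=y$. For $x\ge 0$, the controlled SDE is $$dX_t=\mu(X_t)\,dt+\sigma(X_t)\,dW_t-dD^1_t-dD^2_t,\qquad X_{0-}=x,\qquad 0\le t\le\tau:=\inf\{t\ge 0:X_t\le 0\},$$ $$dD^i_t=\lambda^i(X_t)\,dt+\sum_{j=1}^{n_i}c^i_j\,dL^{x^i_j}_t(X)+\sum_{j=0}^\infty\mathcal J^i(\alpha^j(X_{t-})),\qquad D^i_{0-}=0,$$ where $L^y(X)$ is the symmetric local time of $X$ at $y$. If it has a unique strong solution (a strong solution is adapted to the augmented filtration of $W$; uniqueness is pathwise, on $[0,\tau]$), the expected reward of player $i$ is $$J_i(x,D^1,D^2)=\mathbb E\Big[\int_0^\tau e^{-rt}\,d(D^i_t)^c+\sum_{0\le t\le\tau}e^{-rt}\frac{\Delta D^i_t}{\Delta D^1_t+\Delta D^2_t}\big((\Delta D^1_t+\Delta D^2_t)\wedge X_{t-}\big)\Big],$$ where $(D^i)^c$ is the continuous part of $D^i$, $\Delta D^i_t=D^i_t-D^i_{t-}$, and the sum is over the times with $\Delta D^1_t+\Delta D^2_t>0$;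 otherwise $J_i(x,D^1,D^2)=-\infty$. The pair $(D^1,D^2)$ is a *global Markovian Nash equilibrium* if $J_1(x,D^1,D^2)\ge J_1(x,D,D^2)$ and $J_2(x,D^1,D^2)\ge J_2(x,D^1,D)$ for all $D\in\mathbb L$ and all $x\ge 0$. **Theorem.** Let $(D^1,D^2)\in\mathbb L\times\mathbb L$ satisfy $B^i=[0,\infty)$ and $\mathcal J^i(x)=x$ for all $x\ge 0$, $i=1,2$. Then for every $x\ge 0$ the controlled SDE with $X_{0-}=x$ has a unique strong solution, and $\tau=0$ and $D^1_0=D^2_0=x$ almost surely. Moreover $(D^1,D^2)$ is a global Markovian Nash equilibrium, and the equilibrium values are $$J_1(x,D^1,D^2)=J_2(x,D^1,D^2)=V(x)=\frac x2,\qquad x\ge 0.$$ -/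

import Mathlib

open MeasureTheory ProbabilityTheory Filter Set
open scoped NNReal ENNReal Topology

noncomputable section

namespace ExtractionGame

/-! ## Stochastic analysis on a filtered probability space -/

section StochasticAnalysis

variable {Ω : Type*} {mΩ : MeasurableSpace Ω}

/-- The usual conditions: the space is complete, the filtration is right-continuous and its
initial σ-algebra contains every null set. -/
structure UsualConditions (P : Measure Ω) (𝓕 : Filtration ℝ≥0 mΩ) : Prop where
  complete : P.IsComplete
  rightContinuous : 𝓕.IsRightContinuous
  null_mem : ∀ N : Set Ω, P N = 0 → MeasurableSet[𝓕 0] N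

/-- `W` is a standard one-dimensional Wiener process relative to the filtration `𝓕`. -/
structure IsWienerProcess (P : Measure Ω) (𝓕 : Filtration ℝ≥0 mΩ) (W : ℝ≥0 → Ω → ℝ) : Prop where
  adapted : Adapted 𝓕 W
  brownian : IsBrownianReal W P
  indep_increments : ∀ s t : ℝ≥0, s ≤ t →
    Indep (MeasurableSpace.comap (fun ω => W t ω - W s ω) inferInstance) (𝓕 s) P

/-- Lebesgue measure on the time axis `[0, ∞)`. -/
def lebesgueTime : Measure ℝ≥0 := Measure.comap ((↑) : ℝ≥0 → ℝ) volume

/-- The σ-algebra at time `t` of the augmented filtration generated by `W`. -/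
@[reducible] def augmentedNatural (P : Measure Ω) (W : ℝ≥0 → Ω → ℝ) (t : ℝ≥0) : MeasurableSpace Ω :=
  (⨆ s : Set.Iic t, MeasurableSpace.comap (W s) inferInstance) ⊔
    MeasurableSpace.generateFrom {N : Set Ω | P N = 0}

/-- A right-continuous path with left limits. -/
def IsRCLL (f : ℝ≥0 → ℝ) : Prop :=
  ∀ t, ContinuousWithinAt f (Ici t) t ∧ ∃ l, Tendsto f (𝓝[<] t) (𝓝 l)

/-- The left limit `f (t-)`, where the value `f (0-) = a` is prescribed. -/
def leftValue (a : ℝ) (f : ℝ≥0 → ℝ) (t : ℝ≥0) : ℝ :=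
  if t = 0 then a else Function.leftLim f t

/-- A simple process `∑_{k < n} ξ_k 1_{(t_k, t_{k+1}]}` with `ξ_k` bounded and measurable with
respect to the σ-algebra at time `t_k`. -/
structure SimpleProcess (𝓕 : Filtration ℝ≥0 mΩ) where
  n : ℕ
  time : ℕ → ℝ≥0
  mono : Monotone time
  coeff : ℕ → Ω → ℝ
  coeff_measurable : ∀ k, Measurable[𝓕 (time k)] (coeff k)
  coeff_bounded : ∀ k, ∃ C, ∀ ω, |coeff k ω| ≤ C

/-- The value of a simple process. -/
def SimpleProcess.eval {𝓕 : Filtration ℝ≥0 mΩ} (S : SimpleProcess 𝓕) (t : ℝ≥0) (ω : Ω) : ℝ :=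
  ∑ k ∈ Finset.range S.n,
    (Set.Ioc (S.time k) (S.time (k + 1))).indicator (fun _ => S.coeff k ω) t

/-- The elementary stochastic integral of a simple process with respect to `W` over `[0, t]`. -/
def SimpleProcess.integral {𝓕 : Filtration ℝ≥0 mΩ} (S : SimpleProcess 𝓕) (W : ℝ≥0 → Ω → ℝ)
    (t : ℝ≥0) (ω : Ω) : ℝ :=
  ∑ k ∈ Finset.range S.n,
    S.coeff k ω * (W (min (S.time (k + 1)) t) ω - W (min (S.time k) t) ω)

/-- `I` is (a version of) the Itô integral process `∫_0^t H_s dW_s`, for an integrand with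
`∫_0^t H_s² ds < ∞` a.s.: it is the continuous adapted process which is the limit in probability
of elementary integrals of simple processes `S_k` with `∫_0^t |S_k - H|² ds → 0` in probability. -/
structure IsItoIntegral (P : Measure Ω) (𝓕 : Filtration ℝ≥0 mΩ) (W H I : ℝ≥0 → Ω → ℝ) :
    Prop where
  adapted : Adapted 𝓕 I
  continuous : ∀ᵐ ω ∂P, Continuous (fun t => I t ω)
  square_integrable : ∀ᵐ ω ∂P, ∀ t : ℝ≥0,
    ∫⁻ s in Set.Iic t, ENNReal.ofReal (H s ω ^ 2) ∂lebesgueTime < ⊤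
  approx : ∃ S : ℕ → SimpleProcess 𝓕, ∀ t : ℝ≥0,
    (∀ ε : ℝ≥0∞, 0 < ε → Tendsto (fun k => P {ω | ε ≤
      ∫⁻ s in Set.Iic t, ENNReal.ofReal (((S k).eval s ω - H s ω) ^ 2) ∂lebesgueTime}) atTop (𝓝 0)) ∧
    TendstoInMeasure P (fun k => (S k).integral W t) atTop (I t)

/-- `L` is (a version of) the symmetric local time at level `y` of a semimartingale `X` whose
continuous martingale part has bracket `d⟨X^c⟩_s = q_s ds`:
`L_t = lim_{ε ↓ 0} (1 / 2ε) ∫_0^t 1{y - ε < X_s < y + ε} d⟨X^c⟩_s` in probability,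
with continuous non-decreasing paths. -/
structure IsSymmetricLocalTime (P : Measure Ω) (𝓕 : Filtration ℝ≥0 mΩ) (X q : ℝ≥0 → Ω → ℝ)
    (y : ℝ) (L : ℝ≥0 → Ω → ℝ) : Prop where
  adapted : Adapted 𝓕 L
  continuous : ∀ᵐ ω ∂P, Continuous (fun t => L t ω)
  monotone : ∀ᵐ ω ∂P, Monotone (fun t => L t ω)
  limit : ∀ t : ℝ≥0, TendstoInMeasure P
    (fun (ε : ℝ) ω => 1 / (2 * ε) *
      ∫ s in {s : ℝ≥0 | s ≤ t ∧ y - ε < X s ω ∧ X s ω < y + ε}, q s ω ∂lebesgueTime)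
    (𝓝[>] 0) (L t)

end StochasticAnalysis

/-! ## Admissible control strategies -/

/-- Admissible (Markov) control strategies: an extraction rate `rate`, a jump set `B`, a jump
size function `J`, and finitely many points with local time intensities. The interior of `B` is
taken in `ℝ` (so the interior of `[0, ∞)` is `(0, ∞)`). -/
structure AdmissibleStrategy where
  rate : ℝ≥0 → ℝ≥0
  rate_measurable : Measurable rate
  B : Set ℝ
  B_eq_union : ∃ S : Set (Set ℝ), S.Finite ∧
    (∀ C ∈ S, IsClosed C ∧ IsConnected C ∧ C ⊆ Set.Ici 0) ∧ B = ⋃₀ S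
  J : ℝ≥0 → ℝ≥0
  J_measurable : Measurable J
  J_eq_zero : ∀ x : ℝ≥0, (x : ℝ) ∉ B → J x = 0
  J_le : ∀ x : ℝ≥0, J x ≤ x
  J_pos : ∀ x : ℝ≥0, (x : ℝ) ∈ interior B → 0 < J x
  n : ℕ
  point : Fin n → ℝ
  point_mem : ∀ j, point j ∈ Set.Ioi (0 : ℝ) \ interior B
  intensity : Fin n → ℝ
  intensity_mem : ∀ j, intensity j ∈ Set.Ioc (0 : ℝ) 1

/-- The state after one aggregated jump, `α(y) = (y - J¹(y) - J²(y)) ∨ 0`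
(subtraction in `ℝ≥0` is truncated at `0`). -/
def afterJump (D : Fin 2 → AdmissibleStrategy) (y : ℝ≥0) : ℝ≥0 :=
  y - ∑ i, (D i).J y

/-- The total jump `∑_{j ≥ 0} Jⁱ(α^j(y))` of player `i` when the pre-jump state is `y`. -/
def totalJump (D : Fin 2 → AdmissibleStrategy) (i : Fin 2) (y : ℝ≥0) : ℝ≥0∞ :=
  ∑' j : ℕ, ((D i).J ((afterJump D)^[j] y) : ℝ≥0∞)

/-! ## The controlled SDE -/

section ControlledSDE

variable {Ω : Type*} {mΩ : MeasurableSpace Ω}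

/-- The absorption time `τ = inf {t ≥ 0 : X_t ≤ 0}` (equal to `∞` if there is no such `t`). -/
def absorptionTime (X : ℝ≥0 → Ω → ℝ) (ω : Ω) : ℝ≥0∞ :=
  ⨅ t ∈ {t : ℝ≥0 | X t ω ≤ 0}, (t : ℝ≥0∞)

/-- The times `s ∈ [0, t ∧ τ]`. -/
def activeTimes (X : ℝ≥0 → Ω → ℝ) (t : ℝ≥0) (ω : Ω) : Set ℝ≥0 :=
  {s | s ≤ t ∧ (s : ℝ≥0∞) ≤ absorptionTime X ω}

/-- The diffusion coefficient along `X`, switched off after absorption. -/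
def stoppedDiffusion (σ : ℝ≥0 → ℝ) (X : ℝ≥0 → Ω → ℝ) (s : ℝ≥0) (ω : Ω) : ℝ :=
  {s' : ℝ≥0 | (s' : ℝ≥0∞) ≤ absorptionTime X ω}.indicator (fun s' => σ (X s' ω).toNNReal) s

/-- `X` solves the controlled SDE started from `X_{0-} = x` with control processes `A 0`, `A 1`,
`dX = μ(X) dt + σ(X) dW - dA⁰ - dA¹` on `[0, τ]`, where
`dAⁱ = λⁱ(X) dt + ∑_j cⁱ_j dL^{xⁱ_j}(X) + ∑_j Jⁱ(α^j(X_{t-}))`, `Aⁱ_{0-} = 0`;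
all processes are kept constant after the absorption time `τ`. -/
structure IsSolution (P : Measure Ω) (𝓕 : Filtration ℝ≥0 mΩ) (W : ℝ≥0 → Ω → ℝ) (μ σ : ℝ≥0 → ℝ)
    (x : ℝ≥0) (D : Fin 2 → AdmissibleStrategy) (X : ℝ≥0 → Ω → ℝ) (A : Fin 2 → ℝ≥0 → Ω → ℝ) :
    Prop where
  adapted : Adapted 𝓕 X
  rcll : ∀ᵐ ω ∂P, IsRCLL (fun t => X t ω)
  control_adapted : ∀ i, Adapted 𝓕 (A i)
  rate_finite : ∀ i, ∀ᵐ ω ∂P, ∀ t,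
    ∫⁻ s in activeTimes X t ω, ((D i).rate (X s ω).toNNReal : ℝ≥0∞) ∂lebesgueTime < ⊤
  jump_finite : ∀ i, ∀ᵐ ω ∂P, ∀ t,
    ∑' s : activeTimes X t ω, totalJump D i (leftValue x (X · ω) s).toNNReal < ⊤
  control_eq : ∀ i, ∃ L : Fin (D i).n → ℝ≥0 → Ω → ℝ,
    (∀ j, IsSymmetricLocalTime P 𝓕 X (fun s ω => stoppedDiffusion σ X s ω ^ 2)
      ((D i).point j) (L j)) ∧
    ∀ᵐ ω ∂P, ∀ t, A i t ω =
      (∫⁻ s in activeTimes X t ω, ((D i).rate (X s ω).toNNReal : ℝ≥0∞)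
        ∂lebesgueTime).toReal +
      ∑ j, (D i).intensity j * L j t ω +
      (∑' s : activeTimes X t ω, totalJump D i (leftValue x (X · ω) s).toNNReal).toReal
  drift_integrable : ∀ᵐ ω ∂P, ∀ t,
    IntegrableOn (fun s => μ (X s ω).toNNReal) (activeTimes X t ω) lebesgueTime
  state_eq : ∃ I : ℝ≥0 → Ω → ℝ, IsItoIntegral P 𝓕 W (stoppedDiffusion σ X) I ∧
    ∀ᵐ ω ∂P, ∀ t, X t ω =
      x + (∫ s in activeTimes X t ω, μ (X s ω).toNNReal ∂lebesgueTime) + I t ω - ∑ i, A i t ω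

/-- A strong solution is a solution whose state process is adapted to the augmented filtration
generated by the Wiener process. -/
def IsStrongSolution (P : Measure Ω) (𝓕 : Filtration ℝ≥0 mΩ) (W : ℝ≥0 → Ω → ℝ) (μ σ : ℝ≥0 → ℝ)
    (x : ℝ≥0) (D : Fin 2 → AdmissibleStrategy) (X : ℝ≥0 → Ω → ℝ) (A : Fin 2 → ℝ≥0 → Ω → ℝ) :
    Prop :=
  IsSolution P 𝓕 W μ σ x D X A ∧ ∀ t, Measurable[augmentedNatural P W t] (X t)

/-- Existence of a strong solution, and pathwise uniqueness of the state process on `[0, τ]`, the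
time interval on which the controlled SDE is posed. -/
def HasUniqueStrongSolution (P : Measure Ω) (𝓕 : Filtration ℝ≥0 mΩ) (W : ℝ≥0 → Ω → ℝ)
    (μ σ : ℝ≥0 → ℝ) (x : ℝ≥0) (D : Fin 2 → AdmissibleStrategy) : Prop :=
  (∃ Z : (ℝ≥0 → Ω → ℝ) × (Fin 2 → ℝ≥0 → Ω → ℝ), IsStrongSolution P 𝓕 W μ σ x D Z.1 Z.2) ∧
  ∀ X A X' A', IsSolution P 𝓕 W μ σ x D X A → IsSolution P 𝓕 W μ σ x D X' A' →
    ∀ᵐ ω ∂P, ∀ t : ℝ≥0, (t : ℝ≥0∞) ≤ absorptionTime X ω → X t ω = X' t ω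

/-! ## Expected rewards and equilibrium -/

/-- The jump `ΔA_t = A_t - A_{t-}` of a control path, with `A_{0-} = 0`. -/
def jumpAt (a : ℝ≥0 → ℝ) (t : ℝ≥0) : ℝ := a t - leftValue 0 a t

/-- The continuous part `A^c_t = A_t - ∑_{s ≤ t} ΔA_s` of a control path. -/
def continuousPart (a : ℝ≥0 → ℝ) (t : ℝ≥0) : ℝ := a t - ∑' s : Set.Iic t, jumpAt a s

open scoped Classical in
/-- The Lebesgue-Stieltjes measure `da` of a non-decreasing path (with no mass at `0`). -/
def stieltjesMeasure (a : ℝ≥0 → ℝ) : Measure ℝ≥0 :=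
  if h : Monotone a then h.stieltjesFunction.measure else 0

/-- The discounted pathwise reward of player `i`:
`∫_0^τ e^{-rt} d(Aⁱ)^c_t + ∑_{t ≤ τ} e^{-rt} (ΔAⁱ_t / (ΔA⁰_t + ΔA¹_t)) ((ΔA⁰_t + ΔA¹_t) ∧ X_{t-})`,
the sum being over the times with `ΔA⁰_t + ΔA¹_t > 0`. -/
def pathReward (r : ℝ) (x : ℝ≥0) (X : ℝ≥0 → Ω → ℝ) (A : Fin 2 → ℝ≥0 → Ω → ℝ) (i : Fin 2) (ω : Ω) :
    ℝ≥0∞ :=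
  (∫⁻ t in {t : ℝ≥0 | (t : ℝ≥0∞) ≤ absorptionTime X ω}, ENNReal.ofReal (Real.exp (-r * t))
      ∂(stieltjesMeasure (continuousPart (A i · ω)))) +
  ∑' t : {t : ℝ≥0 | (t : ℝ≥0∞) ≤ absorptionTime X ω ∧ 0 < ∑ k, jumpAt (A k · ω) t},
    ENNReal.ofReal (Real.exp (-r * (t : ℝ≥0)) *
      (jumpAt (A i · ω) t / ∑ k, jumpAt (A k · ω) t) *
      min (∑ k, jumpAt (A k · ω) t) (leftValue x (X · ω) t))

open scoped Classical in
/-- The expected reward of player `i`, which is `-∞` when the controlled SDE started from `x` has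
no unique strong solution. -/
def expectedReward (P : Measure Ω) (𝓕 : Filtration ℝ≥0 mΩ) (W : ℝ≥0 → Ω → ℝ) (μ σ : ℝ≥0 → ℝ)
    (r : ℝ) (i : Fin 2) (x : ℝ≥0) (D : Fin 2 → AdmissibleStrategy) : EReal :=
  if h : HasUniqueStrongSolution P 𝓕 W μ σ x D then
    ((∫⁻ ω, pathReward r x h.1.choose.1 h.1.choose.2 i ω ∂P : ℝ≥0∞) : EReal)
  else ⊥

/-- A global Markovian Nash equilibrium: from no initial state can a player gain by unilaterally
switching to another admissible strategy. -/
def IsGlobalMarkovianNash (P : Measure Ω) (𝓕 : Filtration ℝ≥0 mΩ) (W : ℝ≥0 → Ω → ℝ)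
    (μ σ : ℝ≥0 → ℝ) (r : ℝ) (D : Fin 2 → AdmissibleStrategy) : Prop :=
  ∀ (i : Fin 2) (D' : AdmissibleStrategy) (x : ℝ≥0),
    expectedReward P 𝓕 W μ σ r i x (Function.update D i D') ≤
      expectedReward P 𝓕 W μ σ r i x D

end ControlledSDE

end ExtractionGame

end

/-!
If one player's jump size is the whole state, `J y = y`, then the first aggregated jump already
empties the state, whatever the opponent does: `α(y) = 0`, so each series `∑_j Jⁱ(α^j(y))` reduces
to its first term. Hence `ΔAⁱ_0 = Jⁱ(x)`, the post-jump state `x - ∑ i, Jⁱ(x)` is nonpositive and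
`τ = 0`. Everything that could contribute besides this one jump vanishes at time `0`: the Lebesgue
integrals run over the null set `{0}`, the Itô integral and the local times are limits of
expressions that are zero at `t = 0`, and the Stieltjes measure of the continuous part has no mass
at `0` (`IsSolution.initial_values`, `pathReward_of_absorptionTime_eq_zero`). The reward of player
`i` is therefore the deterministic number `Jⁱ(x) / (∑ k, Jᵏ(x)) * min (∑ k, Jᵏ(x)) x`
(`expectedReward_eq`).

Against an opponent who extracts everything this number is `j x / (j + x)` with `j = Jⁱ(x) ≤ x`. It
increases in `j`, and equals `x / 2` at the maximal choice `j = x`, which gives the equilibrium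
property and the value at once. Under the profile itself the solution is explicit: the state is
constantly `-x` and both controls are constantly `x`.
-/

namespace ExtractionGame

/-! ### Jumps when one player extracts everything -/

section Jumps

lemma AdmissibleStrategy.J_zero (S : AdmissibleStrategy) : S.J 0 = 0 :=
  le_antisymm (S.J_le 0) zero_le

variable {E : Fin 2 → AdmissibleStrategy} {k : Fin 2}

lemma afterJump_eq_zero (hk : ∀ y, (E k).J y = y) (y : ℝ≥0) : afterJump E y = 0 := by
  refine tsub_eq_zero_of_le ?_
  calc y = (E k).J y := (hk y).symm
    _ ≤ ∑ i, (E i).J y :=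
      Finset.single_le_sum (f := fun i => (E i).J y) (fun _ _ => zero_le) (Finset.mem_univ k)

lemma totalJump_eq (hk : ∀ y, (E k).J y = y) (i : Fin 2) (y : ℝ≥0) :
    totalJump E i y = (E i).J y := by
  rw [totalJump, tsum_eq_single 0]
  · simp
  · intro n hn
    obtain ⟨m, rfl⟩ := Nat.exists_eq_succ_of_ne_zero hn
    rw [Function.iterate_succ_apply', afterJump_eq_zero hk, AdmissibleStrategy.J_zero,
      ENNReal.coe_zero]

end Jumps

/-! ### Time zero -/

section TimeZero

lemma lebesgueTime_singleton (t : ℝ≥0) : lebesgueTime {t} = 0 := by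
  have h : MeasurableEmbedding ((↑) : ℝ≥0 → ℝ) :=
    MeasurableEmbedding.subtype_coe measurableSet_Ici
  rw [lebesgueTime, h.comap_apply]
  simp

variable {Ω : Type*} {mΩ : MeasurableSpace Ω}

lemma absorptionTime_eq_zero {X : ℝ≥0 → Ω → ℝ} {ω : Ω} (h : X 0 ω ≤ 0) :
    absorptionTime X ω = 0 :=
  le_antisymm (iInf₂_le_of_le (0 : ℝ≥0) h (by simp)) zero_le

lemma activeTimes_zero (X : ℝ≥0 → Ω → ℝ) (ω : Ω) : activeTimes X 0 ω = {0} := by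
  ext s
  simp only [activeTimes, mem_ofPred_eq, mem_singleton_iff, nonpos_iff_eq_zero]
  exact ⟨fun h => h.1, fun h => ⟨h, by simp [h]⟩⟩

lemma setOf_le_absorptionTime {X : ℝ≥0 → Ω → ℝ} {ω : Ω} (h : absorptionTime X ω = 0) :
    {s : ℝ≥0 | (s : ℝ≥0∞) ≤ absorptionTime X ω} = {0} := by
  ext s
  simp [h]

lemma activeTimes_of_absorptionTime_eq_zero {X : ℝ≥0 → Ω → ℝ} {ω : Ω}
    (h : absorptionTime X ω = 0) (t : ℝ≥0) : activeTimes X t ω = {0} := by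
  ext s
  simp only [activeTimes, h, mem_ofPred_eq, mem_singleton_iff, nonpos_iff_eq_zero,
    ENNReal.coe_eq_zero]
  exact ⟨fun hs => hs.2, fun hs => ⟨hs ▸ zero_le, hs⟩⟩

lemma tsum_totalJump_singleton (E : Fin 2 → AdmissibleStrategy) (i : Fin 2) (x : ℝ≥0)
    (f : ℝ≥0 → ℝ) {s : Set ℝ≥0} (hs : s = {0}) :
    ∑' t : s, totalJump E i (leftValue x f t).toNNReal = totalJump E i x := by
  subst hs
  rw [tsum_singleton (0 : ℝ≥0) (fun t => totalJump E i (leftValue x f t).toNNReal)]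
  simp [leftValue]

lemma IsItoIntegral.ae_eq_zero_at_zero {P : Measure Ω} {𝓕 : Filtration ℝ≥0 mΩ}
    {W H I : ℝ≥0 → Ω → ℝ} (h : IsItoIntegral P 𝓕 W H I) : ∀ᵐ ω ∂P, I 0 ω = 0 := by
  obtain ⟨S, hS⟩ := h.approx
  have h0 : (fun k => (S k).integral W 0) = fun _ _ => (0 : ℝ) := by
    ext k ω
    simp [SimpleProcess.integral]
  have h1 := (hS 0).2
  rw [h0] at h1
  exact tendstoInMeasure_ae_unique h1 (fun ε hε => by simp [hε.ne'])

lemma IsSymmetricLocalTime.ae_eq_zero_at_zero {P : Measure Ω} {𝓕 : Filtration ℝ≥0 mΩ}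
    {X q L : ℝ≥0 → Ω → ℝ} {y : ℝ} (h : IsSymmetricLocalTime P 𝓕 X q y L) :
    ∀ᵐ ω ∂P, L 0 ω = 0 := by
  have h1 := h.limit 0
  have h0 : (fun (ε : ℝ) ω => 1 / (2 * ε) *
      ∫ s in {s : ℝ≥0 | s ≤ 0 ∧ y - ε < X s ω ∧ X s ω < y + ε}, q s ω ∂lebesgueTime) =
      fun _ _ => (0 : ℝ) := by
    ext ε ω
    have hnull : lebesgueTime {s : ℝ≥0 | s ≤ 0 ∧ y - ε < X s ω ∧ X s ω < y + ε} = 0 :=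
      measure_mono_null (fun s hs => nonpos_iff_eq_zero.1 hs.1) (lebesgueTime_singleton 0)
    rw [setIntegral_measure_zero _ hnull, mul_zero]
  rw [h0] at h1
  exact tendstoInMeasure_ae_unique h1 (fun ε hε => by simp [hε.ne'])

/-- A solution at time `0`, when player `k` extracts everything: both controls make exactly one
jump, and the state is moved by these jumps only. -/
lemma IsSolution.initial_values {P : Measure Ω} {𝓕 : Filtration ℝ≥0 mΩ} {W : ℝ≥0 → Ω → ℝ}
    {μ σ : ℝ≥0 → ℝ} {x : ℝ≥0} {E : Fin 2 → AdmissibleStrategy} {k : Fin 2}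
    (hk : ∀ y, (E k).J y = y) {X : ℝ≥0 → Ω → ℝ} {A : Fin 2 → ℝ≥0 → Ω → ℝ}
    (h : IsSolution P 𝓕 W μ σ x E X A) :
    ∀ᵐ ω ∂P, (∀ i, A i 0 ω = (E i).J x) ∧ X 0 ω = x - ∑ i, ((E i).J x : ℝ) := by
  have hA : ∀ᵐ ω ∂P, ∀ i, A i 0 ω = (E i).J x := by
    rw [ae_all_iff]
    intro i
    obtain ⟨L, hL, hLA⟩ := h.control_eq i
    filter_upwards [hLA, ae_all_iff.2 fun j => (hL j).ae_eq_zero_at_zero] with ω hω hL0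
    rw [hω 0, tsum_totalJump_singleton E i x _ (activeTimes_zero X ω), totalJump_eq hk,
      activeTimes_zero, setLIntegral_measure_zero _ _ (lebesgueTime_singleton 0)]
    simp [hL0]
  obtain ⟨I, hI, hX⟩ := h.state_eq
  filter_upwards [hA, hI.ae_eq_zero_at_zero, hX] with ω hω hI0 hXω
  refine ⟨hω, ?_⟩
  rw [hXω 0, activeTimes_zero, setIntegral_measure_zero _ (lebesgueTime_singleton 0), hI0]
  simp [hω]

lemma IsSolution.ae_absorptionTime_eq_zero {P : Measure Ω} {𝓕 : Filtration ℝ≥0 mΩ}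
    {W : ℝ≥0 → Ω → ℝ} {μ σ : ℝ≥0 → ℝ} {x : ℝ≥0} {E : Fin 2 → AdmissibleStrategy} {k : Fin 2}
    (hk : ∀ y, (E k).J y = y) {X : ℝ≥0 → Ω → ℝ} {A : Fin 2 → ℝ≥0 → Ω → ℝ}
    (h : IsSolution P 𝓕 W μ σ x E X A) : ∀ᵐ ω ∂P, absorptionTime X ω = 0 := by
  filter_upwards [h.initial_values hk] with ω hω
  refine absorptionTime_eq_zero ?_
  rw [hω.2, sub_nonpos]
  calc (x : ℝ) = (E k).J x := by rw [hk]
    _ ≤ ∑ i, ((E i).J x : ℝ) :=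
      Finset.single_le_sum (f := fun i => ((E i).J x : ℝ)) (fun _ _ => NNReal.coe_nonneg _)
        (Finset.mem_univ k)

end TimeZero

/-! ### Rewards under immediate absorption -/

section Rewards

variable {Ω : Type*} {mΩ : MeasurableSpace Ω}

lemma stieltjesMeasure_singleton_zero (a : ℝ≥0 → ℝ) : stieltjesMeasure a {0} = 0 := by
  unfold stieltjesMeasure
  split_ifs with h
  · rw [StieltjesFunction.measure_singleton,
      leftLim_eq_of_eq_bot _ (by simp), sub_self,
      ENNReal.ofReal_zero]
  · rfl

/-- Only the jump at time `0` is rewarded. If nobody jumps, the sum over jump times is empty, and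
the right-hand side is zero as well because of `0 / 0 = 0`. -/
lemma pathReward_of_absorptionTime_eq_zero (r : ℝ) (x : ℝ≥0) {X : ℝ≥0 → Ω → ℝ}
    {A : Fin 2 → ℝ≥0 → Ω → ℝ} {ω : Ω} (hτ : absorptionTime X ω = 0) {a : Fin 2 → ℝ≥0}
    (hA : ∀ i, A i 0 ω = a i) (i : Fin 2) :
    pathReward r x X A i ω =
      ENNReal.ofReal ((a i : ℝ) / (∑ k, (a k : ℝ)) * min (∑ k, (a k : ℝ)) x) := by
  have hjump : ∀ k, jumpAt (A k · ω) 0 = a k := fun k => by simp [jumpAt, leftValue, hA]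
  rw [pathReward, setOf_le_absorptionTime hτ,
    setLIntegral_measure_zero _ _ (stieltjesMeasure_singleton_zero _), zero_add]
  rcases (Finset.sum_nonneg fun k _ => NNReal.coe_nonneg (a k) :
    (0 : ℝ) ≤ ∑ k, (a k : ℝ)).eq_or_lt with hs | hs
  · have hempty : {t : ℝ≥0 | (t : ℝ≥0∞) ≤ absorptionTime X ω ∧
        0 < ∑ k, jumpAt (A k · ω) t} = ∅ := by
      refine eq_empty_of_forall_notMem fun t ht => ?_
      have ht0 : t = 0 := by simpa [hτ] using ht.1
      have h2 := ht.2
      simp only [ht0, hjump, ← hs, lt_irrefl] at h2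
    rw [hempty, tsum_empty]
    simp [← hs]
  · have hsing : {t : ℝ≥0 | (t : ℝ≥0∞) ≤ absorptionTime X ω ∧
        0 < ∑ k, jumpAt (A k · ω) t} = {0} := by
      ext t
      simp only [hτ, mem_ofPred_eq, mem_singleton_iff, nonpos_iff_eq_zero, ENNReal.coe_eq_zero]
      refine ⟨fun h => h.1, fun h => ⟨h, ?_⟩⟩
      simpa only [h, hjump] using hs
    rw [hsing, tsum_singleton (0 : ℝ≥0) (fun t => ENNReal.ofReal (Real.exp (-r * (t : ℝ≥0)) *
      (jumpAt (A i · ω) t / ∑ k, jumpAt (A k · ω) t) *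
      min (∑ k, jumpAt (A k · ω) t) (leftValue x (X · ω) t)))]
    simp only [hjump]
    simp [leftValue]

lemma expectedReward_eq {P : Measure Ω} [IsProbabilityMeasure P] {𝓕 : Filtration ℝ≥0 mΩ}
    {W : ℝ≥0 → Ω → ℝ} {μ σ : ℝ≥0 → ℝ} {x : ℝ≥0} {E : Fin 2 → AdmissibleStrategy} {k : Fin 2}
    (hk : ∀ y, (E k).J y = y) (h : HasUniqueStrongSolution P 𝓕 W μ σ x E) (r : ℝ) (i : Fin 2) :
    expectedReward P 𝓕 W μ σ r i x E =
      (((E i).J x / (∑ k, ((E k).J x : ℝ)) * min (∑ k, ((E k).J x : ℝ)) x : ℝ) : EReal) := by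
  have hsol := h.1.choose_spec.1
  rw [expectedReward, dif_pos h, lintegral_congr_ae
    (g := fun _ => ENNReal.ofReal
      ((E i).J x / (∑ k, ((E k).J x : ℝ)) * min (∑ k, ((E k).J x : ℝ)) x)) ?_]
  · rw [lintegral_const, measure_univ, mul_one, EReal.coe_ennreal_ofReal, max_eq_left]
    positivity
  · filter_upwards [hsol.ae_absorptionTime_eq_zero hk, hsol.initial_values hk] with ω hτ hω
    exact pathReward_of_absorptionTime_eq_zero r x hτ hω.1 i

lemma div_add_mul_min_le_half {j x : ℝ} (hj : 0 ≤ j) (hjx : j ≤ x) :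
    j / (j + x) * min (j + x) x ≤ x / 2 := by
  rw [min_eq_right (by linarith)]
  rcases (add_nonneg hj (hj.trans hjx)).eq_or_lt with h | h
  · rw [← h]
    simp only [div_zero, zero_mul]
    linarith
  · have h1 : j / (j + x) ≤ 1 / 2 := by
      rw [div_le_div_iff₀ h two_pos]
      linarith
    linarith [mul_le_mul_of_nonneg_right h1 (hj.trans hjx)]

lemma div_add_self_mul_min {x : ℝ} (hx : 0 ≤ x) : x / (x + x) * min (x + x) x = x / 2 := by
  rw [min_eq_right (by linarith)]
  rcases hx.eq_or_lt with rfl | h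
  · simp
  · field_simp
    norm_num

end Rewards

/-! ### Existence and pathwise uniqueness -/

section Existence

variable {Ω : Type*} {mΩ : MeasurableSpace Ω}

/-- The zero process is the Itô integral of an integrand supported at the single time `0`. -/
lemma isItoIntegral_zero (P : Measure Ω) (𝓕 : Filtration ℝ≥0 mΩ) (W : ℝ≥0 → Ω → ℝ)
    {H : ℝ≥0 → Ω → ℝ} (hH : ∀ t ≠ 0, ∀ ω, H t ω = 0) :
    IsItoIntegral P 𝓕 W H (fun _ _ => 0) := by
  have hnull : ∀ t ω, ∫⁻ s in Set.Iic t, ENNReal.ofReal (H s ω ^ 2) ∂lebesgueTime = 0 := by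
    intro t ω
    have hae : ∀ᵐ s ∂(lebesgueTime.restrict (Set.Iic t)), ENNReal.ofReal (H s ω ^ 2) = 0 := by
      refine ae_restrict_of_ae ?_
      filter_upwards [compl_mem_ae_iff.2 (lebesgueTime_singleton 0)] with s hs
      simp [hH s hs ω]
    rw [lintegral_congr_ae hae, lintegral_zero]
  let S : SimpleProcess 𝓕 :=
    { n := 0
      time := fun _ => 0
      mono := monotone_const
      coeff := fun _ _ => 0
      coeff_measurable := fun _ => measurable_const
      coeff_bounded := fun _ => ⟨0, by simp⟩ }
  refine ⟨fun _ => measurable_const, by simp [continuous_const], ?_, fun _ => S, fun t => ⟨?_, ?_⟩⟩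
  · exact ae_of_all _ fun ω t => by simp [hnull]
  · intro ε hε
    simp only [SimpleProcess.eval, S, Finset.range_zero, Finset.sum_empty, zero_sub, neg_sq, hnull]
    simp [hε.ne']
  · intro ε hε
    simp [SimpleProcess.integral, S, hε.ne']

lemma AdmissibleStrategy.n_eq_zero {S : AdmissibleStrategy} (hB : S.B = Set.Ici 0) : S.n = 0 := by
  by_contra hn
  have h := S.point_mem ⟨0, Nat.pos_of_ne_zero hn⟩
  rw [hB, interior_Ici] at h
  exact h.2 h.1

/-- When both players extract everything, the constant state `-x` with the constant controls `x`
is a strong solution: the two simultaneous jumps of size `x` take the state from `x` to `-x`, where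
it stays because it is absorbed. -/
lemma isStrongSolution_const (P : Measure Ω) (𝓕 : Filtration ℝ≥0 mΩ) (W : ℝ≥0 → Ω → ℝ)
    (μ σ : ℝ≥0 → ℝ) (x : ℝ≥0) {D : Fin 2 → AdmissibleStrategy}
    (hB : ∀ i, (D i).B = Set.Ici 0) (hJ : ∀ i y, (D i).J y = y) :
    IsStrongSolution P 𝓕 W μ σ x D (fun _ _ => -x) (fun _ _ _ => x) := by
  have hτ : ∀ ω : Ω, absorptionTime (fun _ _ => -(x : ℝ)) ω = 0 :=
    fun ω => absorptionTime_eq_zero (by simp)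
  have hact : ∀ t (ω : Ω), activeTimes (fun _ _ => -(x : ℝ)) t ω = {0} :=
    fun t ω => activeTimes_of_absorptionTime_eq_zero (hτ ω) t
  have htotal : ∀ i, totalJump D i x = x := fun i => by rw [totalJump_eq (hJ 0), hJ]
  refine ⟨⟨fun _ => measurable_const, ?_, fun _ _ => measurable_const, ?_, ?_, ?_, ?_, ?_⟩,
    fun _ => measurable_const⟩
  · exact ae_of_all _ fun ω t => ⟨continuousWithinAt_const, _, tendsto_const_nhds⟩
  · refine fun i => ae_of_all _ fun ω t => ?_
    rw [hact, setLIntegral_measure_zero _ _ (lebesgueTime_singleton 0)]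
    exact ENNReal.zero_lt_top
  · refine fun i => ae_of_all _ fun ω t => ?_
    rw [tsum_totalJump_singleton D i x _ (hact t ω), htotal]
    exact ENNReal.coe_lt_top
  · intro i
    have hn := AdmissibleStrategy.n_eq_zero (hB i)
    have : IsEmpty (Fin (D i).n) := by rw [hn]; infer_instance
    refine ⟨isEmptyElim, isEmptyElim, ae_of_all _ fun ω t => ?_⟩
    rw [tsum_totalJump_singleton D i x _ (hact t ω), htotal, hact,
      setLIntegral_measure_zero _ _ (lebesgueTime_singleton 0)]
    simp
  · refine ae_of_all _ fun ω t => ?_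
    rw [hact, IntegrableOn, Measure.restrict_eq_zero.2 (lebesgueTime_singleton 0)]
    exact integrable_zero_measure
  · refine ⟨fun _ _ => 0, isItoIntegral_zero P 𝓕 W fun t ht ω => ?_, ae_of_all _ fun ω t => ?_⟩
    · rw [stoppedDiffusion, setOf_le_absorptionTime (hτ ω)]
      simp [ht]
    · rw [hact, setIntegral_measure_zero _ (lebesgueTime_singleton 0), Fin.sum_univ_two]
      ring

/-- Since `τ = 0`, pathwise uniqueness on `[0, τ]` only concerns the state at time `0`. -/
lemma hasUniqueStrongSolution (P : Measure Ω) (𝓕 : Filtration ℝ≥0 mΩ) (W : ℝ≥0 → Ω → ℝ)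
    (μ σ : ℝ≥0 → ℝ) (x : ℝ≥0) {D : Fin 2 → AdmissibleStrategy}
    (hB : ∀ i, (D i).B = Set.Ici 0) (hJ : ∀ i y, (D i).J y = y) :
    HasUniqueStrongSolution P 𝓕 W μ σ x D := by
  refine ⟨⟨(_, _), isStrongSolution_const P 𝓕 W μ σ x hB hJ⟩, fun X A X' A' h h' => ?_⟩
  filter_upwards [h.ae_absorptionTime_eq_zero (hJ 0), h.initial_values (hJ 0),
    h'.initial_values (hJ 0)] with ω hτ hω hω' t ht
  obtain rfl : t = 0 := by simpa [hτ] using ht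
  rw [hω.2, hω'.2]

end Existence

end ExtractionGame

theorem theorem2p6 {Ω : Type*} {mΩ : MeasurableSpace Ω} (P : Measure Ω) [IsProbabilityMeasure P]
    (𝓕 : Filtration ℝ≥0 mΩ) (h𝓕 : ExtractionGame.UsualConditions P 𝓕)
    (W : ℝ≥0 → Ω → ℝ) (hW : ExtractionGame.IsWienerProcess P 𝓕 W)
    (μ σ : ℝ≥0 → ℝ) (hμ : Measurable μ) (hσ : Measurable σ) (r : ℝ) (hr : 0 < r)
    (D : Fin 2 → ExtractionGame.AdmissibleStrategy)
    (hB : ∀ i, (D i).B = Set.Ici 0) (hJ : ∀ i y, (D i).J y = y) :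
    ExtractionGame.IsGlobalMarkovianNash P 𝓕 W μ σ r D ∧
    (∀ (i : Fin 2) (x : ℝ≥0),
      ExtractionGame.expectedReward P 𝓕 W μ σ r i x D = (((x : ℝ) / 2 : ℝ) : EReal)) ∧
    (∀ x : ℝ≥0, ExtractionGame.HasUniqueStrongSolution P 𝓕 W μ σ x D ∧
      ∀ X A, ExtractionGame.IsSolution P 𝓕 W μ σ x D X A →
        ∀ᵐ ω ∂P, ExtractionGame.absorptionTime X ω = 0 ∧ ∀ i, A i 0 ω = x) := by
  have huniq : ∀ x, ExtractionGame.HasUniqueStrongSolution P 𝓕 W μ σ x D :=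
    fun x => ExtractionGame.hasUniqueStrongSolution P 𝓕 W μ σ x hB hJ
  have hvalue : ∀ (i : Fin 2) (x : ℝ≥0),
      ExtractionGame.expectedReward P 𝓕 W μ σ r i x D = (((x : ℝ) / 2 : ℝ) : EReal) := by
    intro i x
    rw [ExtractionGame.expectedReward_eq (hJ 0) (huniq x)]
    simp only [hJ, Fin.sum_univ_two]
    rw [ExtractionGame.div_add_self_mul_min x.coe_nonneg]
  refine ⟨fun i D' x => ?_, hvalue, fun x => ⟨huniq x, fun X A h => ?_⟩⟩
  · rw [hvalue]
    by_cases h : ExtractionGame.HasUniqueStrongSolution P 𝓕 W μ σ x (Function.update D i D')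
    · obtain ⟨k, hki⟩ := exists_ne i
      -- The opponent `k` of the deviating player still extracts everything.
      have hk : ∀ y, (Function.update D i D' k).J y = y := by simp [hki, hJ]
      have hsum : ∑ l, ((Function.update D i D' l).J x : ℝ) = D'.J x + x := by
        rw [Fintype.sum_eq_add i k hki.symm (by omega), hk, Function.update_self]
      rw [ExtractionGame.expectedReward_eq hk h, hsum, Function.update_self]
      exact EReal.coe_le_coe (ExtractionGame.div_add_mul_min_le_half (D'.J x).coe_nonneg
        (NNReal.coe_le_coe.2 (D'.J_le x)))
    · rw [ExtractionGame.expectedReward, dif_neg h]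
      exact bot_le
  · filter_upwards [h.ae_absorptionTime_eq_zero (hJ 0), h.initial_values (hJ 0)] with ω hτ hω
    exact ⟨hτ, fun i => by rw [hω.1, hJ]⟩
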